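/- Let $d\ge 0$ and $N\geq 1$ be integers and let $\Sigma\in\mathbb{R}^{d\times d}$ be a positive semidefinite matrix (possibly singular), with trace $\mathrm{Tr}(\Sigma)$ and Euclidean operator norm $\|\Sigma\|_{op}$. For $\mu\in\mathbb{R}^d$ let $\mathbb{P}_\mu^N$ be the law of $N$ i.i.d. random vectors $X_1,\dots,X_N$ with distribution $\mathcal N(\mu,\Sigma)$. An estimator is a measurable map $\hat\mu:(\mathbb{R}^d)^N\to\mathbb{R}^d$. (1) Let $\delta\in(0,1/4]$, $r^*\in\mathbb{R}$, and let $\hat\mu$ be an estimator (all three may depend on each other and on $d,N,\Sigma$) such that $$\mathbb{P}_{\mu^*}^N\big[\|\hat\mu-\mu^*\|_2\le r^*\big]\ \ge\ 1-\delta\qquad\text{for all }\mu^*\in\mathbb{R}^d .$$ Then $$r^*\ \ge\ \max\left(\frac1{24}\sqrt{\frac{\log 2}{2\log(5/4)}}\,\sqrt{\frac{\mathrm{Tr}(\Sigma)}{N}},\ \ \frac1{12}\sqrt{\frac{\|\Sigma\|_{op}\log(1/\delta)}{N}}\right).$$ (2) For all $\delta\in(0,1)$ the empirical mean $\bar X_N=\frac1N\sum_{i=1}^N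 X_i$ satisfies, for all $\mu\in\mathbb{R}^d$, with $\mathbb{P}_\mu^N$-probability at least $1-\delta$, $$\|\bar X_N-\mu\|_2\ \le\ R_N(\delta):=\sqrt{\frac{\mathrm{Tr}(\Sigma)}{N}}+\sqrt{\frac{2\|\Sigma\|_{op}\log(1/\delta)}{N}} .$$ (3) Hence this subgaussian rate is deviation-minimax optimal: there is an absolute constant $C>0$ (independent of $d,N,\Sigma,\delta,\hat\mu,r^*$) such that $R_N(\delta)\le C\,r^*$ in every situation described in (1). -/

import Mathlib

open MeasureTheory ProbabilityTheory

/-- The law of an i.i.d. sample `(X₁, …, X_N)` of the Gaussian distribution on `ℝ^d` with mean `μ`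
and covariance matrix `V`. -/
noncomputable def gaussianSample {d : ℕ} (N : ℕ) (V : Matrix (Fin d) (Fin d) ℝ)
    (μ : EuclideanSpace ℝ (Fin d)) : Measure (Fin N → EuclideanSpace ℝ (Fin d)) :=
  Measure.pi fun _ => multivariateGaussian μ V

/-- The estimator `est` has accuracy `r` with confidence `1 - δ` in Euclidean norm, uniformly over
all mean vectors `μ`, when the data are `N` i.i.d. Gaussian vectors with covariance `V`. -/
def IsAccurate {d N : ℕ} (V : Matrix (Fin d) (Fin d) ℝ)
    (est : (Fin N → EuclideanSpace ℝ (Fin d)) → EuclideanSpace ℝ (Fin d)) (δ r : ℝ) : Prop :=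
  ∀ μ : EuclideanSpace ℝ (Fin d), 1 - δ ≤ (gaussianSample N V μ).real {x | ‖est x - μ‖ ≤ r}

/-- The operator norm of `V` acting on Euclidean space. -/
noncomputable def euclideanOpNorm {d : ℕ} (V : Matrix (Fin d) (Fin d) ℝ) : ℝ :=
  ‖Matrix.toEuclideanCLM (n := Fin d) (𝕜 := ℝ) V‖

/-- The empirical mean of `N` vectors. -/
noncomputable def empiricalMean {d N : ℕ} (x : Fin N → EuclideanSpace ℝ (Fin d)) :
    EuclideanSpace ℝ (Fin d) :=
  (N : ℝ)⁻¹ • ∑ i, x i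

/-- The subgaussian rate of the empirical mean for covariance `V`, sample size `N` and
confidence `1 - δ`. -/
noncomputable def subgaussianRate {d : ℕ} (V : Matrix (Fin d) (Fin d) ℝ) (N : ℕ) (δ : ℝ) : ℝ :=
  √(V.trace / N) + √(2 * euclideanOpNorm V * Real.log (1 / δ) / N)

/-! Lower bound: give the mean a Gaussian prior `M` with covariance `Σ / N`, so that the prior and
the averaged noise `ḡ` have the same law. Exchanging `M` and `ḡ` preserves both the joint law and
the observations `M + g i`, so with probability at least `1 - 2δ` the same estimate lies within `r`
of both, and `‖M - ḡ‖ ≤ 2r`. As `M - ḡ` has covariance `2Σ / N`, a centered Gaussian with covariance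
`Σ` lies in the ball of radius `√(2N) r` with probability at least `1 - 2δ`
(`measure_norm_le_of_accurate`). In an eigenbasis this is a statement about `∑ λ i * x i ^ 2`. A
small ball estimate bounds the trace (`sum_le_of_half_le_measure`), and the tail of a single
coordinate bounds each eigenvalue (`log_le_of_le_measure_abs_le`). Upper bound: the centered
empirical mean is a rescaled Gaussian, and a Chernoff bound controls its quadratic form
(`measure_lt_sum_sq_le`). -/

/-! ### Gaussian prior and the exchange symmetry. -/

section GaussianProduct

variable {E : Type*} [NormedAddCommGroup E] [NormedSpace ℝ E]

variable (E) in
/-- The empirical mean as a continuous linear map. -/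
noncomputable def meanCLM (N : ℕ) :
    (Fin N → E) →L[ℝ] E :=
  (N : ℝ)⁻¹ • ∑ i, ContinuousLinearMap.proj i

lemma meanCLM_apply (N : ℕ) (x : Fin N → E) : meanCLM E N x = (N : ℝ)⁻¹ • ∑ i, x i := by
  simp [meanCLM]

lemma meanCLM_single (N : ℕ) (k : Fin N) (v : E) :
    meanCLM E N (Pi.single k v) = (N : ℝ)⁻¹ • v := by
  rw [meanCLM_apply, Finset.sum_pi_single' ]
  simp

variable (E) in
/-- Exchange of the random mean and of the empirical mean of the noise; it does not change the
observations, which are the sums of the random mean and the noise. -/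
noncomputable def swapCLM (N : ℕ) :
    (E × (Fin N → E)) →L[ℝ] (E × (Fin N → E)) :=
  ((meanCLM E N).comp (.snd ℝ E (Fin N → E))).prod (ContinuousLinearMap.pi fun j =>
    (ContinuousLinearMap.proj j).comp (.snd ℝ E (Fin N → E)) - (meanCLM E N).comp (.snd ℝ E (Fin N → E)) +
      .fst ℝ E (Fin N → E))

lemma swapCLM_apply (N : ℕ) (p : E × (Fin N → E)) :
    swapCLM E N p = (meanCLM E N p.2, fun j => p.2 j - meanCLM E N p.2 + p.1) := by
  ext <;> simp [swapCLM]

variable [SecondCountableTopology E] [CompleteSpace E] [MeasurableSpace E] [BorelSpace E]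

lemma charFunDual_map_smul_of_centered (ν : Measure E) [IsGaussian ν] (h0 : ∫ x, x ∂ν = 0)
    (a : ℝ) (L : StrongDual ℝ E) :
    charFunDual (ν.map (a • ContinuousLinearMap.id ℝ E)) L =
      Complex.exp (-((a ^ 2 * covarianceBilinDual ν L L : ℝ) : ℂ) / 2) := by
  have : L.comp (a • ContinuousLinearMap.id ℝ E) = a • L := by ext; simp
  rw [charFunDual_map, this, IsGaussian.charFunDual_eq']
  congr 1
  simp [h0]
  ring

lemma charFunDual_of_centered (ν : Measure E) [IsGaussian ν] (h0 : ∫ x, x ∂ν = 0)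
    (L : StrongDual ℝ E) :
    charFunDual ν L = Complex.exp (-((covarianceBilinDual ν L L : ℝ) : ℂ) / 2) := by
  rw [IsGaussian.charFunDual_eq']
  congr 1
  simp [h0]
  ring

lemma charFunDual_pi_of_centered (ν : Measure E) [IsGaussian ν] (h0 : ∫ x, x ∂ν = 0) (N : ℕ)
    (L : StrongDual ℝ (Fin N → E)) :
    charFunDual (Measure.pi fun _ : Fin N => ν) L =
      Complex.exp (-((∑ j, covarianceBilinDual ν (L.comp (.single ℝ (fun _ : Fin N => E) j))
        (L.comp (.single ℝ (fun _ : Fin N => E) j)) : ℝ) : ℂ) / 2) := by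
  rw [charFunDual_pi]
  simp_rw [charFunDual_of_centered ν h0, ← Complex.exp_sum]
  congr 1
  push_cast
  rw [← Finset.sum_div, Finset.sum_neg_distrib]

/-- The empirical mean of `N` independent centered Gaussian vectors is one such vector scaled by
`1 / √N`. -/
lemma map_meanCLM_pi (ν : Measure E) [IsGaussian ν] (h0 : ∫ x, x ∂ν = 0) {N : ℕ} (hN : 0 < N) :
    (Measure.pi fun _ : Fin N => ν).map (meanCLM E N) =
      ν.map ((√(N : ℝ))⁻¹ • ContinuousLinearMap.id ℝ E) := by
  apply Measure.ext_of_charFunDual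
  ext L
  have hN' : (N : ℝ) ≠ 0 := by positivity
  have hL (j : Fin N) : (L.comp (meanCLM E N)).comp (.single ℝ (fun _ : Fin N => E) j) = (N : ℝ)⁻¹ • L := by
    ext v
    simp [meanCLM_single]
  rw [charFunDual_map, charFunDual_pi_of_centered ν h0, charFunDual_map_smul_of_centered ν h0]
  congr 4
  simp only [hL, map_smul, _root_.smul_apply, smul_eq_mul, Finset.sum_const,
    Finset.card_univ, Fintype.card_fin, nsmul_eq_mul, inv_pow, Real.sq_sqrt (Nat.cast_nonneg N)]
  field_simp

/-- Joint law of a random mean and of the centered noise of `N` observations. -/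
noncomputable def priorNoise (ν : Measure E) (N : ℕ) : Measure (E × (Fin N → E)) :=
  (ν.map ((√(N : ℝ))⁻¹ • ContinuousLinearMap.id ℝ E)).prod (Measure.pi fun _ => ν)

instance (ν : Measure E) [IsProbabilityMeasure ν] (N : ℕ) :
    IsProbabilityMeasure (priorNoise ν N) := by
  have : IsProbabilityMeasure (ν.map ((√(N : ℝ))⁻¹ • ContinuousLinearMap.id ℝ E)) :=
    Measure.isProbabilityMeasure_map (by fun_prop)
  unfold priorNoise
  infer_instance

lemma charFunDual_priorNoise (ν : Measure E) [IsGaussian ν] (h0 : ∫ x, x ∂ν = 0) (N : ℕ)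
    (L : StrongDual ℝ (E × (Fin N → E))) :
    charFunDual (priorNoise ν N) L =
      Complex.exp (-(((N : ℝ)⁻¹ * covarianceBilinDual ν (L.comp (.inl ℝ E (Fin N → E)))
          (L.comp (.inl ℝ E (Fin N → E))) +
        ∑ j, covarianceBilinDual ν ((L.comp (.inr ℝ E (Fin N → E))).comp (.single ℝ (fun _ : Fin N => E) j))
          ((L.comp (.inr ℝ E (Fin N → E))).comp (.single ℝ (fun _ : Fin N => E) j)) : ℝ) : ℂ) / 2) := by
  rw [priorNoise, charFunDual_prod, charFunDual_map_smul_of_centered ν h0,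
    charFunDual_pi_of_centered ν h0, ← Complex.exp_add]
  congr 1
  simp only [inv_pow, Real.sq_sqrt (Nat.cast_nonneg N)]
  push_cast
  ring

/-- Both laws are centered Gaussian, so comparing the variances of linear functionals suffices; this
also covers degenerate `ν`. The prior scale `1 / √N` is what makes them agree. -/
lemma map_swapCLM_priorNoise (ν : Measure E) [IsGaussian ν] (h0 : ∫ x, x ∂ν = 0) {N : ℕ}
    (hN : 0 < N) : (priorNoise ν N).map (swapCLM E N) = priorNoise ν N := by
  apply Measure.ext_of_charFunDual
  ext L
  have hN' : (N : ℝ) ≠ 0 := by positivity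
  rw [charFunDual_map, charFunDual_priorNoise ν h0, charFunDual_priorNoise ν h0]
  set K := L.comp (.inl ℝ E (Fin N → E))
  set ℓ := fun j => (L.comp (.inr ℝ E (Fin N → E))).comp (.single ℝ (fun _ : Fin N => E) j)
  have hdec (p : E × (Fin N → E)) : L p = K p.1 + ∑ j, ℓ j (p.2 j) := by
    rw [← L.comp_inl_add_comp_inr p, 
      ← ContinuousLinearMap.sum_comp_single (φ := fun _ : Fin N => E)
        (L := L.comp (.inr ℝ E (Fin N → E))) (v := p.2)]
  have h1 : (L.comp (swapCLM E N)).comp (.inl ℝ E (Fin N → E)) = ∑ j, ℓ j := by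
    ext v
    simp [hdec, swapCLM_apply]
  have h2 (k : Fin N) : ((L.comp (swapCLM E N)).comp (.inr ℝ E (Fin N → E))).comp (.single ℝ (fun _ : Fin N => E) k) =
      (N : ℝ)⁻¹ • (K - ∑ j, ℓ j) + ℓ k := by
    ext v
    have : ∑ j, ℓ j (Pi.single (M := fun _ => E) k v j) = ℓ k v := by
      rw [Finset.sum_eq_single k] <;> simp +contextual
    simp [hdec, swapCLM_apply, meanCLM_single, Finset.sum_sub_distrib, ← Finset.mul_sum, this]
    ring
  rw [h1]
  simp_rw [h2]
  congr 4
  -- When the variance is expanded, all terms in `B S S` and `B K S` cancel, leaving `N⁻¹ * B K K +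
  -- ∑ j, B (ℓ j) (ℓ j)`.
  set S := ∑ j, ℓ j
  set B := covarianceBilinDual ν
  have hc (a b) : B a b = B b a := covarianceBilinDual_comm a b
  have h3 : ∑ j, B S (ℓ j) = B S S := (map_sum (B S) ℓ Finset.univ).symm
  have h4 : ∑ j, B K (ℓ j) = B K S := (map_sum (B K) ℓ Finset.univ).symm
  simp only [map_add, map_smul, map_sub, _root_.add_apply,
    _root_.sub_apply, _root_.smul_apply, smul_eq_mul,
    Finset.sum_add_distrib, ← Finset.mul_sum, Finset.sum_sub_distrib, Finset.sum_const,
    Finset.card_univ, Fintype.card_fin, nsmul_eq_mul]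
  simp_rw [hc (ℓ _) S, hc (ℓ _) K, h3, h4, hc S K]
  field_simp
  ring

/-- The prior and the averaged noise are independent, each contributing variance `1 / N` times that
of `ν`. -/
lemma map_fst_sub_mean_priorNoise (ν : Measure E) [IsGaussian ν] (h0 : ∫ x, x ∂ν = 0) {N : ℕ}
    (hN : 0 < N) :
    (priorNoise ν N).map (ContinuousLinearMap.fst ℝ E (Fin N → E) -
        (meanCLM E N).comp (ContinuousLinearMap.snd ℝ E (Fin N → E))) =
      ν.map ((√(2 / N : ℝ)) • ContinuousLinearMap.id ℝ E) := by
  apply Measure.ext_of_charFunDual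
  ext L
  have hN' : (N : ℝ) ≠ 0 := by positivity
  rw [charFunDual_map, charFunDual_priorNoise ν h0, charFunDual_map_smul_of_centered ν h0]
  set D := ContinuousLinearMap.fst ℝ E (Fin N → E) -
    (meanCLM E N).comp (ContinuousLinearMap.snd ℝ E (Fin N → E)) with hD
  have h1 : (L.comp D).comp (.inl ℝ E (Fin N → E)) = L := by
    ext v
    simp [hD]
  have h2 (k : Fin N) : ((L.comp D).comp (.inr ℝ E (Fin N → E))).comp (.single ℝ (fun _ : Fin N => E) k) =
      -((N : ℝ)⁻¹ • L) := by
    ext v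
    simp [hD, meanCLM_single]
  rw [h1]
  simp_rw [h2]
  congr 4
  simp only [map_neg, map_smul, _root_.neg_apply, _root_.smul_apply,
    smul_eq_mul, Finset.sum_const, Finset.card_univ, Fintype.card_fin, nsmul_eq_mul,
    Real.sq_sqrt (show (0 : ℝ) ≤ 2 / N by positivity)]
  field_simp
  ring

/-- If an estimator of the mean of a Gaussian measure is accurate, then so is the guess that
a centered Gaussian vector vanishes. -/
lemma measure_norm_le_of_accurate (ν : Measure E) [IsGaussian ν] (h0 : ∫ x, x ∂ν = 0) {N : ℕ}
    (hN : 0 < N) {est : (Fin N → E) → E} (hest : Measurable est) {δ r : ℝ}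
    (hacc : ∀ μ : E, 1 - δ ≤
      ((Measure.pi fun _ : Fin N => ν).map (fun x i => μ + x i)).real {x | ‖est x - μ‖ ≤ r}) :
    1 - 2 * δ ≤ ν.real {z | ‖z‖ ≤ √(2 * N) * r} := by
  have hT := map_swapCLM_priorNoise ν h0 hN
  set A : Set (E × (Fin N → E)) := {p | ‖est (fun i => p.1 + p.2 i) - p.1‖ ≤ r} with hA
  have hAm : MeasurableSet A := by
    apply measurableSet_le _ measurable_const
    have : Measurable fun p : E × (Fin N → E) => (fun i => p.1 + p.2 i) :=
      measurable_pi_lambda _ fun i => by fun_prop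
    exact ((hest.comp this).sub measurable_fst).norm
  have : IsProbabilityMeasure (ν.map ((√(N : ℝ))⁻¹ • ContinuousLinearMap.id ℝ E)) :=
    Measure.isProbabilityMeasure_map (by fun_prop)
  -- Accuracy at every fixed mean survives averaging over the prior.
  have hA1 : 1 - δ ≤ (priorNoise ν N).real A := by
    have hμ (μ : E) : ENNReal.ofReal (1 - δ) ≤
        (Measure.pi fun _ : Fin N => ν) (Prod.mk μ ⁻¹' A) := by
      have hshift : Measurable fun (x : Fin N → E) i => μ + x i :=
        measurable_pi_lambda _ fun i => by fun_prop
      have := hacc μ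
      rw [map_measureReal_apply hshift
        (measurableSet_le (by fun_prop) measurable_const)] at this
      exact ENNReal.ofReal_le_of_le_toReal this
    have : ENNReal.ofReal (1 - δ) ≤ priorNoise ν N A := by
      rw [priorNoise, Measure.prod_apply hAm]
      calc ENNReal.ofReal (1 - δ) =
          ∫⁻ _, ENNReal.ofReal (1 - δ) ∂(ν.map ((√(N : ℝ))⁻¹ • ContinuousLinearMap.id ℝ E)) := by
            rw [lintegral_const, measure_univ, mul_one]
        _ ≤ _ := lintegral_mono hμ
    exact (ENNReal.ofReal_le_iff_le_toReal (measure_ne_top _ _)).1 this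
  have hA2 : 1 - δ ≤ (priorNoise ν N).real (swapCLM E N ⁻¹' A) := by
    rwa [← map_measureReal_apply (by fun_prop) hAm, hT]
  have hTm : MeasurableSet (swapCLM E N ⁻¹' A) := hAm.preimage (by fun_prop)
  have hsub : A ∩ swapCLM E N ⁻¹' A ⊆ (ContinuousLinearMap.fst ℝ E (Fin N → E) -
        (meanCLM E N).comp (ContinuousLinearMap.snd ℝ E (Fin N → E))) ⁻¹' {w | ‖w‖ ≤ 2 * r} := by
    rintro p ⟨h1, h2⟩
    simp only [hA, Set.mem_preimage, Set.mem_ofPred_eq, swapCLM_apply] at h1 h2 ⊢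
    -- The swap leaves the observations unchanged, so both events involve the same estimate `e`.
    have : (fun i => meanCLM E N p.2 + (p.2 i - meanCLM E N p.2 + p.1)) =
        fun i => p.1 + p.2 i := by
      ext i; abel
    rw [this] at h2
    set e := est (fun i => p.1 + p.2 i)
    calc ‖p.1 - meanCLM E N p.2‖ = ‖(e - meanCLM E N p.2) - (e - p.1)‖ := by congr 1; abel
      _ ≤ ‖e - meanCLM E N p.2‖ + ‖e - p.1‖ := norm_sub_le _ _
      _ ≤ 2 * r := by linarith
  have hball : MeasurableSet {w : E | ‖w‖ ≤ 2 * r} := measurableSet_le (by fun_prop) (by fun_prop)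
  have h3 := measureReal_mono (μ := priorNoise ν N) hsub
  rw [← map_measureReal_apply (by fun_prop) hball, map_fst_sub_mean_priorNoise ν h0 hN,
    map_measureReal_apply (by fun_prop) hball] at h3
  have h4 := measureReal_union_add_inter (μ := priorNoise ν N) (s := A) hTm
  have h5 : (priorNoise ν N).real (A ∪ swapCLM E N ⁻¹' A) ≤ 1 := measureReal_le_one
  have h6 : (√(2 / N : ℝ) • ContinuousLinearMap.id ℝ E) ⁻¹' {w | ‖w‖ ≤ 2 * r} =
      {z | ‖z‖ ≤ √(2 * N) * r} := by
    ext z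
    have hs : √(2 * N : ℝ) * √(2 / N) = 2 := by
      rw [← Real.sqrt_mul (by positivity), show (2 * N : ℝ) * (2 / N) = 2 ^ 2 by field_simp]
      exact Real.sqrt_sq (by norm_num)
    have hp : 0 < √(2 * N : ℝ) := by positivity
    simp only [Set.mem_preimage, Set.mem_ofPred_eq, _root_.smul_apply,
      ContinuousLinearMap.id_apply, norm_smul, Real.norm_eq_abs, abs_of_nonneg (Real.sqrt_nonneg _)]
    rw [← mul_le_mul_iff_right₀ hp, ← mul_assoc, hs]
    constructor <;> intro h <;> linarith
  rw [h6] at h3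
  linarith

end GaussianProduct

/-! ### Quadratic forms in independent standard Gaussians. -/

section GaussianQuadratic

lemma one_add_sum_le_prod_one_add {ι : Type*} (s : Finset ι) {f : ι → ℝ} (hf : ∀ i ∈ s, 0 ≤ f i) :
    1 + ∑ i ∈ s, f i ≤ ∏ i ∈ s, (1 + f i) := by
  induction s using Finset.cons_induction with
  | empty => simp
  | cons a s ha ih =>
    rw [Finset.sum_cons, Finset.prod_cons]
    have h1 := ih fun i hi => hf i (Finset.mem_cons_of_mem hi)
    have h2 := hf a (Finset.mem_cons_self a s)
    have h3 : 0 ≤ ∑ i ∈ s, f i := Finset.sum_nonneg fun i hi => hf i (Finset.mem_cons_of_mem hi)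
    nlinarith

lemma gaussianPDFReal_smul_exp_mul_sq (a x : ℝ) :
    gaussianPDFReal 0 1 x • Real.exp (a * x ^ 2) =
      (√(2 * Real.pi))⁻¹ * Real.exp (-(1 / 2 - a) * x ^ 2) := by
  rw [gaussianPDFReal, smul_eq_mul, mul_assoc, ← Real.exp_add]
  simp only [NNReal.coe_one, mul_one]
  congr 2
  ring

lemma integrable_exp_mul_sq_gaussianReal {a : ℝ} (ha : a < 1 / 2) :
    Integrable (fun x => Real.exp (a * x ^ 2)) (gaussianReal 0 1) := by
  rw [gaussianReal_of_var_ne_zero _ one_ne_zero,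
    integrable_withDensity_iff_integrable_smul' (measurable_gaussianPDF _ _)
      (ae_of_all _ fun _ => gaussianPDF_lt_top)]
  simp_rw [toReal_gaussianPDF, gaussianPDFReal_smul_exp_mul_sq]
  exact (integrable_exp_neg_mul_sq (by linarith)).const_mul _

lemma integral_exp_mul_sq_gaussianReal {a : ℝ} (ha : a < 1 / 2) :
    ∫ x, Real.exp (a * x ^ 2) ∂(gaussianReal 0 1) = (√(1 - 2 * a))⁻¹ := by
  have h : 0 < 1 - 2 * a := by linarith
  rw [integral_gaussianReal_eq_integral_smul one_ne_zero]
  simp_rw [gaussianPDFReal_smul_exp_mul_sq]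
  rw [integral_const_mul, integral_gaussian, ← Real.sqrt_inv, ← Real.sqrt_inv,
    ← Real.sqrt_mul (by positivity)]
  congr 1
  have : 1 / 2 - a = (1 - 2 * a) / 2 := by ring
  rw [this]
  field_simp

variable {ι : Type*} [Fintype ι]

lemma integrable_exp_sum_sq_gaussianReal {a : ι → ℝ} (ha : ∀ i, a i < 1 / 2) :
    Integrable (fun x : ι → ℝ => Real.exp (∑ i, a i * x i ^ 2))
      (Measure.pi fun _ => gaussianReal 0 1) := by
  simp_rw [Real.exp_sum]
  exact Integrable.fintype_prod_dep (f := fun i (x : ℝ) => Real.exp (a i * x ^ 2)) fun i =>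
    integrable_exp_mul_sq_gaussianReal (ha i)

lemma integral_exp_sum_sq_gaussianReal {a : ι → ℝ} (ha : ∀ i, a i < 1 / 2) :
    ∫ x : ι → ℝ, Real.exp (∑ i, a i * x i ^ 2) ∂(Measure.pi fun _ => gaussianReal 0 1) =
      ∏ i, (√(1 - 2 * a i))⁻¹ := by
  simp_rw [Real.exp_sum]
  rw [integral_fintype_prod_eq_prod (f := fun i (x : ℝ) => Real.exp (a i * x ^ 2))]
  exact Finset.prod_congr rfl fun i _ => integral_exp_mul_sq_gaussianReal (ha i)

/-- Small ball estimate for a nonnegative quadratic form in independent standard Gaussians. -/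
lemma measure_sum_sq_le_le {lam : ι → ℝ} (hlam : ∀ i, 0 ≤ lam i) {u : ℝ} (hu : 0 ≤ u) (t : ℝ) :
    (Measure.pi fun _ : ι => gaussianReal 0 1).real {x | ∑ i, lam i * x i ^ 2 ≤ t} ≤
      Real.exp (u * t) * (√(1 + 2 * u * ∑ i, lam i))⁻¹ := by
  have ha (i : ι) : -(u * lam i) < 1 / 2 := by
    have := mul_nonneg hu (hlam i)
    linarith
  have hprod : 1 + 2 * u * ∑ i, lam i ≤ ∏ i, (1 + 2 * u * lam i) := by
    rw [Finset.mul_sum]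
    exact one_add_sum_le_prod_one_add _ fun i _ => by have := hlam i; positivity
  have hsum : 0 ≤ ∑ i, lam i := Finset.sum_nonneg fun i _ => hlam i
  have h1 := mul_meas_ge_le_integral_of_nonneg (μ := Measure.pi fun _ : ι => gaussianReal 0 1)
    (ae_of_all _ fun x => (Real.exp_pos (∑ i, -(u * lam i) * x i ^ 2)).le)
    (integrable_exp_sum_sq_gaussianReal ha) (Real.exp (-(u * t)))
  rw [integral_exp_sum_sq_gaussianReal ha] at h1
  have h2 : {x : ι → ℝ | ∑ i, lam i * x i ^ 2 ≤ t} ⊆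
      {x | Real.exp (-(u * t)) ≤ Real.exp (∑ i, -(u * lam i) * x i ^ 2)} := by
    intro x hx
    simp only [Set.mem_ofPred_eq, Real.exp_le_exp] at hx ⊢
    have : ∑ i, -(u * lam i) * x i ^ 2 = -(u * ∑ i, lam i * x i ^ 2) := by
      rw [Finset.mul_sum, ← Finset.sum_neg_distrib]
      exact Finset.sum_congr rfl fun i _ => by ring
    rw [this]
    have := mul_le_mul_of_nonneg_left hx hu
    linarith
  -- Keeping only the first-order part of the product makes the bound depend on the trace alone.
  have h3 : ∏ i, (√(1 - 2 * -(u * lam i)))⁻¹ ≤ (√(1 + 2 * u * ∑ i, lam i))⁻¹ := by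
    rw [Finset.prod_inv_distrib, ← Real.sqrt_prod _ fun i _ => by
      have := mul_nonneg hu (hlam i); linarith]
    refine inv_anti₀ (by positivity) (Real.sqrt_le_sqrt (hprod.trans_eq ?_))
    exact Finset.prod_congr rfl fun i _ => by ring
  calc _ ≤ _ := measureReal_mono h2
    _ = Real.exp (u * t) * (Real.exp (-(u * t)) * _) := by
      rw [← mul_assoc, ← Real.exp_add, add_neg_cancel, Real.exp_zero, one_mul]
    _ ≤ _ := mul_le_mul_of_nonneg_left (h1.trans h3) (Real.exp_pos _).le

/-- A ball of probability at least `1 / 2` has squared radius comparable to the trace. -/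
lemma sum_le_of_half_le_measure {lam : ι → ℝ} (hlam : ∀ i, 0 ≤ lam i) {t : ℝ}
    (h : 1 / 2 ≤ (Measure.pi fun _ : ι => gaussianReal 0 1).real {x | ∑ i, lam i * x i ^ 2 ≤ t}) :
    ∑ i, lam i ≤ 20 * t := by
  by_contra! hlt
  set T := ∑ i, lam i
  have ht : 0 ≤ t := by
    by_contra! ht
    have : {x : ι → ℝ | ∑ i, lam i * x i ^ 2 ≤ t} = ∅ := by
      ext x
      simp only [Set.mem_ofPred_eq, Set.mem_empty_iff_false, iff_false, not_le]
      exact ht.trans_le (Finset.sum_nonneg fun i _ => mul_nonneg (hlam i) (sq_nonneg _))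
    rw [this] at h
    norm_num at h
  have hT : 0 < T := by linarith
  -- If `t < T / 20`, the choice `u = 10 / T` bounds the probability by `exp (1 / 2) / √21 < 2 / 4`,
  -- contradicting `h`.
  have h1 := h.trans (measure_sum_sq_le_le hlam (u := 10 / T) (by positivity) t)
  have h2 : 1 + 2 * (10 / T) * T = 21 := by field_simp; norm_num
  have h3 : Real.exp (10 / T * t) ≤ Real.exp (1 / 2) := by
    rw [Real.exp_le_exp, div_mul_eq_mul_div, div_le_iff₀ hT]
    linarith
  have h4 : Real.exp (1 / 2) < 2 := by
    have := Real.exp_one_lt_d9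
    have h : Real.exp (1 / 2) * Real.exp (1 / 2) = Real.exp 1 := by
      rw [← Real.exp_add]; norm_num
    nlinarith [Real.exp_pos (1 / 2)]
  have h5 : (4 : ℝ) ≤ √21 := Real.le_sqrt_of_sq_le (by norm_num)
  rw [show (∑ i, lam i) = T from rfl, h2, ← div_eq_mul_inv, le_div_iff₀ (by positivity)] at h1
  linarith

/-- This is `1 + z ≤ exp z` at `z = y / (1 - y)`, where `1 + z = (1 - y)⁻¹`, followed by a square
root. -/
lemma inv_sqrt_one_sub_le_exp {y : ℝ} (hy : y < 1) :
    (√(1 - y))⁻¹ ≤ Real.exp (y / (2 * (1 - y))) := by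
  have h : 0 < 1 - y := by linarith
  rw [← Real.sqrt_inv]
  apply Real.sqrt_le_iff.2 ⟨(Real.exp_pos _).le, _⟩
  rw [← Real.exp_nat_mul]
  have := Real.add_one_le_exp (y / (1 - y))
  have h1 : y / (1 - y) + 1 = (1 - y)⁻¹ := by field_simp; ring
  rw [h1] at this
  convert this using 2
  push_cast
  field_simp

/-- Upper deviations of a quadratic form in independent standard Gaussians. -/
lemma measure_lt_sum_sq_le {lam : ι → ℝ} (hlam : ∀ i, 0 ≤ lam i) {σ : ℝ}
    (hσ : ∀ i, lam i ≤ σ) {ℓ : ℝ} (hℓ : 0 ≤ ℓ) :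
    (Measure.pi fun _ : ι => gaussianReal 0 1).real
        {x | (√(∑ i, lam i) + √(2 * σ * ℓ)) ^ 2 < ∑ i, lam i * x i ^ 2} ≤ Real.exp (-ℓ) := by
  set T := ∑ i, lam i with hTdef
  have hT0 : 0 ≤ T := Finset.sum_nonneg fun i _ => hlam i
  -- The Chernoff parameter below needs `σ > 0` and `τ > 0`, so the zero form is treated apart.
  rcases hT0.eq_or_lt with hT | hT
  · have h0 (i : ι) : lam i = 0 :=
      (Finset.sum_eq_zero_iff_of_nonneg fun i _ => hlam i).1 (hTdef.symm.trans hT.symm) i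
        (Finset.mem_univ i)
    have : {x : ι → ℝ | (√T + √(2 * σ * ℓ)) ^ 2 < ∑ i, lam i * x i ^ 2} = ∅ := by
      ext x
      simp only [h0, Set.mem_ofPred_eq, Set.mem_empty_iff_false, iff_false, not_lt, zero_mul,
        Finset.sum_const_zero]
      positivity
    rw [this]
    simpa using (Real.exp_pos _).le
  have hσ0 : 0 < σ := by
    by_contra! h
    have : T ≤ 0 := Finset.sum_nonpos fun i _ => (hσ i).trans h
    linarith
  set s := √(2 * σ * ℓ) with hs
  have hs0 : 0 ≤ s := Real.sqrt_nonneg _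
  have hs2 : s ^ 2 = 2 * σ * ℓ := Real.sq_sqrt (by positivity)
  set τ := √T with hτ
  have hτ0 : 0 < τ := Real.sqrt_pos.2 hT
  have hτ2 : τ ^ 2 = T := Real.sq_sqrt hT0
  -- This `c` minimises `-c (τ + s) ^ 2 + c τ ^ 2 / (1 - 2 c σ)`; the minimum is `-s ^ 2 / (2 σ) =
  -- -ℓ`.
  set c := s / (2 * σ * (τ + s)) with hc
  have hc0 : 0 ≤ c := by positivity
  have hq : 1 - 2 * c * σ = τ / (τ + s) := by rw [hc]; field_simp; ring
  have hq0 : 0 < 1 - 2 * c * σ := by rw [hq]; positivity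
  have hcl (i : ι) : c * lam i ≤ c * σ := mul_le_mul_of_nonneg_left (hσ i) hc0
  have ha (i : ι) : c * lam i < 1 / 2 := by linarith [hcl i]
  have h1 := mul_meas_ge_le_integral_of_nonneg (μ := Measure.pi fun _ : ι => gaussianReal 0 1)
    (ae_of_all _ fun x => (Real.exp_pos (∑ i, c * lam i * x i ^ 2)).le)
    (integrable_exp_sum_sq_gaussianReal ha) (Real.exp (c * (τ + s) ^ 2))
  rw [integral_exp_sum_sq_gaussianReal ha] at h1
  have h2 : {x : ι → ℝ | (τ + s) ^ 2 < ∑ i, lam i * x i ^ 2} ⊆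
      {x | Real.exp (c * (τ + s) ^ 2) ≤ Real.exp (∑ i, c * lam i * x i ^ 2)} := by
    intro x hx
    simp only [Set.mem_ofPred_eq, Real.exp_le_exp] at hx ⊢
    simp_rw [mul_assoc, ← Finset.mul_sum]
    exact mul_le_mul_of_nonneg_left hx.le hc0
  -- Each denominator is replaced by the smallest possible one, `1 - 2 c σ`, so the exponents sum to
  -- a multiple of the trace.
  have h3 : ∏ i, (√(1 - 2 * (c * lam i)))⁻¹ ≤ Real.exp (c * T / (1 - 2 * c * σ)) := by
    calc ∏ i, (√(1 - 2 * (c * lam i)))⁻¹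
        ≤ ∏ i, Real.exp (c * lam i / (1 - 2 * c * σ)) := by
          refine Finset.prod_le_prod (fun i _ => by positivity) fun i _ => ?_
          have hci : 0 ≤ c * lam i := mul_nonneg hc0 (hlam i)
          refine (inv_sqrt_one_sub_le_exp (by linarith [ha i])).trans ?_
          rw [Real.exp_le_exp, mul_div_mul_left _ _ two_ne_zero]
          exact div_le_div_of_nonneg_left hci hq0 (by linarith [hcl i])
      _ = _ := by rw [← Real.exp_sum, ← Finset.sum_div, ← Finset.mul_sum]
  have h4 : -(c * (τ + s) ^ 2) + c * T / (1 - 2 * c * σ) = -ℓ := by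
    rw [hq, ← hτ2]
    have : ℓ = s ^ 2 / (2 * σ) := by rw [hs2]; field_simp
    rw [this, hc]
    field_simp
    ring
  calc _ ≤ _ := measureReal_mono h2
    _ = Real.exp (-(c * (τ + s) ^ 2)) * (Real.exp (c * (τ + s) ^ 2) * _) := by
      rw [← mul_assoc, ← Real.exp_add, neg_add_cancel, Real.exp_zero, one_mul]
    _ ≤ Real.exp (-(c * (τ + s) ^ 2)) * Real.exp (c * T / (1 - 2 * c * σ)) :=
      mul_le_mul_of_nonneg_left (h1.trans h3) (Real.exp_pos _).le
    _ = _ := by rw [← Real.exp_add, h4]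

/-- Lower bound for the tail of the standard Gaussian distribution. -/
lemma log_le_of_le_measure_abs_le {a δ : ℝ} (hδ : 0 < δ) (ha0 : 0 ≤ a) (ha : 1 ≤ 20 * a ^ 2)
    (h : 1 - 2 * δ ≤ (gaussianReal 0 1).real {x | |x| ≤ a}) :
    Real.log (1 / δ) ≤ 72 * a ^ 2 := by
  have hm : MeasurableSet {x : ℝ | |x| ≤ a} := measurableSet_le (by fun_prop) (by fun_prop)
  have h1 : Real.exp (-(16 * a ^ 2)) / 3 ≤ (gaussianReal 0 1).real {x | |x| ≤ a}ᶜ := by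
    -- The density on a unit interval beyond `a` already suffices for the tail.
    have hsub : Set.Ioc a (a + 1) ⊆ {x : ℝ | |x| ≤ a}ᶜ := by
      intro x hx
      simp only [Set.mem_compl_iff, Set.mem_ofPred_eq, not_le]
      exact hx.1.trans_le (le_abs_self x)
    refine le_trans ?_ (measureReal_mono hsub)
    have hpdf (x) (hx : x ∈ Set.Ioc a (a + 1)) :
        Real.exp (-(16 * a ^ 2)) / 3 ≤ gaussianPDFReal 0 1 x := by
      rw [gaussianPDFReal, div_eq_inv_mul]
      simp only [NNReal.coe_one, mul_one, sub_zero]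
      refine mul_le_mul ?_ ?_ (Real.exp_pos _).le (by positivity)
      · refine inv_anti₀ (by positivity) (Real.sqrt_le_iff.2 ⟨by norm_num, ?_⟩)
        linarith [Real.pi_lt_four]
      · rw [Real.exp_le_exp]
        have : x ^ 2 ≤ (a + 1) ^ 2 := by
          have := hx.1
          exact pow_le_pow_left₀ (by linarith) hx.2 2
        -- Since `a` is bounded away from `0`, `(a + 1) ^ 2 / 2 ≤ 16 * a ^ 2`.
        have h5 : (1 : ℝ) ≤ 9 / 2 * a := by nlinarith
        nlinarith
    rw [measureReal_def, gaussianReal_apply_eq_integral _ one_ne_zero,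
      ENNReal.toReal_ofReal (integral_nonneg fun x => gaussianPDFReal_nonneg _ _ _)]
    calc Real.exp (-(16 * a ^ 2)) / 3
        = ∫ _ in Set.Ioc a (a + 1), Real.exp (-(16 * a ^ 2)) / 3 := by simp
      _ ≤ _ := setIntegral_mono_on (by simp) (integrable_gaussianPDFReal _ _).integrableOn
          measurableSet_Ioc hpdf
  rw [probReal_compl_eq_one_sub hm] at h1
  have h2 : Real.exp (-(16 * a ^ 2)) ≤ 6 * δ := by linarith
  -- The factor `6` is absorbed into the exponent, as `56 * a ^ 2 ≥ 2.8`; then `72 = 16 + 56`.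
  have h3 : Real.exp (-(16 * a ^ 2)) ≤ Real.exp (56 * a ^ 2) * δ := by
    refine h2.trans (mul_le_mul_of_nonneg_right ?_ hδ.le)
    have h6 : (2.8 : ℝ) ≤ 56 * a ^ 2 := by linarith
    have := Real.quadratic_le_exp_of_nonneg (x := 56 * a ^ 2) (by positivity)
    nlinarith
  have h4 : Real.exp (-(72 * a ^ 2)) ≤ δ := by
    have : Real.exp (-(72 * a ^ 2)) = Real.exp (-(56 * a ^ 2)) * Real.exp (-(16 * a ^ 2)) := by
      rw [← Real.exp_add]; congr 1; ring
    rw [this]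
    calc _ ≤ Real.exp (-(56 * a ^ 2)) * (Real.exp (56 * a ^ 2) * δ) :=
          mul_le_mul_of_nonneg_left h3 (Real.exp_pos _).le
      _ = δ := by rw [← mul_assoc, ← Real.exp_add, neg_add_cancel, Real.exp_zero, one_mul]
  have := (Real.le_log_iff_exp_le hδ).2 h4
  rw [one_div, Real.log_inv]
  linarith

end GaussianQuadratic

/-! ### Diagonalisation and the two bounds for multivariate Gaussians. -/

section Multivariate

open scoped RealInnerProductSpace

/-- A centered Gaussian vector with covariance `V` is, in an orthonormal eigenbasis of `V`, a vector
of independent centered real Gaussian variables whose variances are the eigenvalues of `V`. -/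
lemma exists_diagonal_multivariateGaussian {d : ℕ} {V : Matrix (Fin d) (Fin d) ℝ}
    (hV : V.PosSemidef) :
    ∃ (lam : Fin d → ℝ) (f : (Fin d → ℝ) → EuclideanSpace ℝ (Fin d)), Measurable f ∧
      (Measure.pi fun _ => gaussianReal 0 1).map f = multivariateGaussian 0 V ∧
      (∀ x, ‖f x‖ ^ 2 = ∑ i, lam i * x i ^ 2) ∧ (∀ i, 0 ≤ lam i) ∧ ∑ i, lam i = V.trace ∧
      (∀ i, lam i ≤ euclideanOpNorm V) ∧
      ∀ M, 0 ≤ M → (∀ i, lam i ≤ M) → euclideanOpNorm V ≤ M := by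
  set lam := hV.isHermitian.eigenvalues with hlam
  set b := hV.isHermitian.eigenvectorBasis with hb
  have hlam0 (i) : 0 ≤ lam i := hV.eigenvalues_nonneg i
  have hVb (i) : Matrix.toEuclideanCLM (𝕜 := ℝ) V (b i) = lam i • b i := by
    ext j
    simpa using congrFun (hV.isHermitian.mulVec_eigenvectorBasis i) j
  have hVt (t : EuclideanSpace ℝ (Fin d)) : Matrix.toEuclideanCLM (𝕜 := ℝ) V t =
      ∑ i, (lam i * ⟪b i, t⟫) • b i := by
    conv_lhs => rw [← b.sum_repr' t]
    rw [map_sum]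
    refine Finset.sum_congr rfl fun i _ => ?_
    rw [map_smul, hVb, smul_smul, mul_comm]
  have hnorm (c : Fin d → ℝ) : ‖∑ i, c i • b i‖ ^ 2 = ∑ i, c i ^ 2 := by
    rw [← b.sum_sq_inner_right]
    refine Finset.sum_congr rfl fun i _ => ?_
    rw [b.orthonormal.inner_right_fintype]
  refine ⟨lam, fun x => ∑ i, (√(lam i) * x i) • b i, by fun_prop, ?_, ?_, hlam0, ?_, ?_, ?_⟩
  · have : IsProbabilityMeasure ((Measure.pi fun _ : Fin d => gaussianReal 0 1).map
        fun x => ∑ i, (√(lam i) * x i) • b i) :=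
      Measure.isProbabilityMeasure_map (Measurable.aemeasurable (by fun_prop))
    apply Measure.ext_of_charFun
    ext t
    have hq : (t.ofLp ⬝ᵥ Matrix.mulVec V t.ofLp : ℝ) = ∑ i, lam i * ⟪b i, t⟫ ^ 2 := by
      rw [← Matrix.inner_toEuclideanCLM, hVt, inner_sum]
      refine Finset.sum_congr rfl fun i _ => ?_
      rw [real_inner_smul_right, real_inner_comm]
      ring
    rw [charFun_multivariateGaussian hV, hq, charFun_apply,
      integral_map (Measurable.aemeasurable (by fun_prop))
        (Measurable.aestronglyMeasurable (by fun_prop))]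
    have hterm (i : Fin d) (y : ℝ) : (⟪(√(lam i) * y) • b i, t⟫ : ℝ) =
        (√(lam i) * ⟪b i, t⟫) * y := by
      rw [real_inner_smul_left]; ring
    simp_rw [sum_inner, hterm, Complex.ofReal_sum, Finset.sum_mul, Complex.exp_sum]
    rw [integral_fintype_prod_eq_prod
      (f := fun i (y : ℝ) => Complex.exp (((√(lam i) * ⟪b i, t⟫ * y : ℝ) : ℂ) * Complex.I))]
    have hcoord (i : Fin d) : ∫ y, Complex.exp (((√(lam i) * ⟪b i, t⟫ * y : ℝ) : ℂ) * Complex.I)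
        ∂(gaussianReal 0 1) = Complex.exp (((-(lam i * ⟪b i, t⟫ ^ 2 / 2) : ℝ) : ℂ)) := by
      simp_rw [fun y : ℝ => Complex.ofReal_mul (√(lam i) * ⟪b i, t⟫) y]
      rw [← charFun_apply_real, charFun_gaussianReal, ← Complex.ofReal_pow, mul_pow,
        Real.sq_sqrt (hlam0 i)]
      simp
    simp_rw [hcoord, ← Complex.exp_sum, ← Complex.ofReal_sum]
    congr 1
    simp [Finset.sum_div]
  · intro x
    rw [hnorm]
    refine Finset.sum_congr rfl fun i _ => ?_
    rw [mul_pow, Real.sq_sqrt (hlam0 i)]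
  · rw [hV.isHermitian.trace_eq_sum_eigenvalues]
    simp [hlam]
  · intro i
    have := (Matrix.toEuclideanCLM (n := Fin d) (𝕜 := ℝ) V).le_opNorm (b i)
    rwa [hVb, norm_smul, b.norm_eq_one, mul_one, mul_one, Real.norm_eq_abs,
      abs_of_nonneg (hlam0 i)] at this
  -- Quantifying over upper bounds `M ≥ 0` instead of naming a largest eigenvalue also covers `d =
  -- 0`.
  · intro M hM h
    refine ContinuousLinearMap.opNorm_le_bound _ hM fun t => ?_
    apply le_of_sq_le_sq _ (by positivity)
    rw [hVt, hnorm, mul_pow, ← b.sum_sq_inner_right t, Finset.mul_sum]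
    refine Finset.sum_le_sum fun i _ => ?_
    rw [mul_pow]
    gcongr
    · exact hlam0 i
    · exact h i

lemma gaussianSample_eq_map {d : ℕ} (N : ℕ) (V : Matrix (Fin d) (Fin d) ℝ)
    (μ : EuclideanSpace ℝ (Fin d)) :
    gaussianSample N V μ =
      (Measure.pi fun _ : Fin N => multivariateGaussian 0 V).map fun x i => μ + x i := by
  have h : (multivariateGaussian 0 V).map (fun x => μ + x) = multivariateGaussian μ V := by
    rw [multivariateGaussian, multivariateGaussian, Measure.map_map (by fun_prop) (by fun_prop)]
    congr 1
    ext x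
    simp
  have : IsProbabilityMeasure ((multivariateGaussian 0 V).map fun x => μ + x) := by
    rw [h]; infer_instance
  rw [Measure.pi_map_pi (fun _ => by fun_prop), h, gaussianSample]

/-- The bounds that the existence of an accurate estimator imposes on the accuracy. -/
lemma IsAccurate.bounds {d N : ℕ} (hN : 0 < N) {V : Matrix (Fin d) (Fin d) ℝ}
    (hV : V.PosSemidef) {est : (Fin N → EuclideanSpace ℝ (Fin d)) → EuclideanSpace ℝ (Fin d)}
    (hest : Measurable est) {δ : ℝ} (hδ : 0 < δ) (hδ4 : δ ≤ 1 / 4) {r : ℝ}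
    (h : IsAccurate V est δ r) :
    0 ≤ r ∧ V.trace / N ≤ 40 * r ^ 2 ∧
      euclideanOpNorm V * Real.log (1 / δ) / N ≤ 144 * r ^ 2 := by
  have hN0 : (0 : ℝ) < N := by positivity
  have hr : 0 ≤ r := by
    by_contra! hr
    have h0 := h 0
    have : {x : Fin N → EuclideanSpace ℝ (Fin d) | ‖est x - 0‖ ≤ r} = ∅ := by
      ext x
      simp only [Set.mem_ofPred_eq, Set.mem_empty_iff_false, iff_false, not_le]
      exact hr.trans_le (norm_nonneg _)
    rw [this, measureReal_empty] at h0
    linarith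
  obtain ⟨lam, f, hf, hmap, hnorm, hlam0, htr, -, hop⟩ := exists_diagonal_multivariateGaussian hV
  have h1 := measure_norm_le_of_accurate (multivariateGaussian 0 V)
    integral_id_multivariateGaussian hN hest (δ := δ) (r := r) fun μ => by
      rw [← gaussianSample_eq_map]; exact h μ
  rw [← hmap, map_measureReal_apply hf (measurableSet_le (by fun_prop) (by fun_prop))] at h1
  have hset : f ⁻¹' {z | ‖z‖ ≤ √(2 * N) * r} =
      {x | ∑ i, lam i * x i ^ 2 ≤ 2 * N * r ^ 2} := by
    ext x
    rw [Set.mem_preimage, Set.mem_ofPred_eq, Set.mem_ofPred_eq, ← hnorm,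
      ← sq_le_sq₀ (norm_nonneg _) (by positivity), mul_pow, Real.sq_sqrt (by positivity)]
  rw [hset] at h1
  -- Here `δ ≤ 1 / 4` enters, giving `1 - 2 * δ ≥ 1 / 2`.
  have hT := sum_le_of_half_le_measure hlam0 (le_trans (by linarith) h1)
  have hlog : 0 < Real.log (1 / δ) := Real.log_pos (by rw [lt_div_iff₀ hδ]; linarith)
  refine ⟨hr, ?_, ?_⟩
  · rw [← htr, div_le_iff₀ hN0]
    linarith
  · have key (i : Fin d) : lam i ≤ 144 * r ^ 2 * N / Real.log (1 / δ) := by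
      rcases (hlam0 i).eq_or_lt with hi | hi
      · rw [← hi]; positivity
      rw [le_div_iff₀ hlog]
      set a := √(2 * N * r ^ 2 / lam i) with ha
      have ha2 : a ^ 2 = 2 * N * r ^ 2 / lam i := Real.sq_sqrt (by positivity)
      -- The trace bound supplies the lower bound on `a` required by the one-dimensional tail
      -- estimate.
      have hle : lam i ≤ 20 * (2 * N * r ^ 2) :=
        (Finset.single_le_sum (fun j _ => hlam0 j) (Finset.mem_univ i)).trans hT
      have ha20 : 1 ≤ 20 * a ^ 2 := by
        rw [ha2, ← mul_div_assoc, le_div_iff₀ hi]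
        linarith
      have hsub : {x : Fin d → ℝ | ∑ i, lam i * x i ^ 2 ≤ 2 * N * r ^ 2} ⊆
          Function.eval i ⁻¹' {y : ℝ | |y| ≤ a} := by
        intro x hx
        simp only [Set.mem_ofPred_eq, Set.mem_preimage, Function.eval] at hx ⊢
        apply Real.abs_le_sqrt
        rw [le_div_iff₀ hi, mul_comm]
        exact (Finset.single_le_sum (f := fun j => lam j * x j ^ 2)
          (fun j _ => mul_nonneg (hlam0 j) (sq_nonneg _)) (Finset.mem_univ i)).trans hx
      have h2 := h1.trans (measureReal_mono hsub)
      rw [(measurePreserving_eval (fun _ : Fin d => gaussianReal 0 1) i).measureReal_preimage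
        (measurableSet_le (by fun_prop) (by fun_prop)).nullMeasurableSet] at h2
      have h3 := log_le_of_le_measure_abs_le hδ (Real.sqrt_nonneg _) ha20 h2
      rw [ha2, ← mul_div_assoc, le_div_iff₀ hi] at h3
      linarith
    have := hop _ (by positivity) key
    rw [le_div_iff₀ hlog] at this
    rw [div_le_iff₀ hN0]
    exact this

/-- The empirical mean of a Gaussian sample attains the subgaussian rate. -/
lemma isAccurate_empiricalMean {d N : ℕ} (hN : 0 < N) {V : Matrix (Fin d) (Fin d) ℝ}
    (hV : V.PosSemidef) {δ : ℝ} (hδ : 0 < δ) (hδ1 : δ < 1) :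
    IsAccurate V (empiricalMean (N := N)) δ (subgaussianRate V N δ) := by
  intro μ
  have hN0 : (0 : ℝ) < N := by positivity
  have hℓ : 0 ≤ Real.log (1 / δ) := Real.log_nonneg (by rw [le_div_iff₀ hδ]; linarith)
  obtain ⟨lam, f, hf, hmap, hnorm, hlam0, htr, hlam, -⟩ := exists_diagonal_multivariateGaussian hV
  have hmean : Measurable (empiricalMean : (Fin N → EuclideanSpace ℝ (Fin d)) → EuclideanSpace ℝ (Fin d)) := by
    unfold empiricalMean
    fun_prop
  have hshift : Measurable fun (x : Fin N → EuclideanSpace ℝ (Fin d)) i => μ + x i :=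
    measurable_pi_lambda _ fun i => by fun_prop
  set R := subgaussianRate V N δ with hR
  have hball : MeasurableSet {w : EuclideanSpace ℝ (Fin d) | ‖w‖ ≤ R} := measurableSet_le (by fun_prop) (by fun_prop)
  have h1 : (gaussianSample N V μ).real {x | ‖empiricalMean x - μ‖ ≤ R} =
      (multivariateGaussian 0 V).real
        (((√(N : ℝ))⁻¹ • ContinuousLinearMap.id ℝ (EuclideanSpace ℝ (Fin d))) ⁻¹' {w | ‖w‖ ≤ R}) := by
    rw [← map_measureReal_apply (by fun_prop) hball,
      ← map_meanCLM_pi _ integral_id_multivariateGaussian hN, gaussianSample_eq_map,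
      map_measureReal_apply hshift
        (measurableSet_le (by fun_prop) measurable_const),
      map_measureReal_apply (by fun_prop) hball]
    congr 1
    ext x
    have : empiricalMean (fun i => μ + x i) - μ = meanCLM (EuclideanSpace ℝ (Fin d)) N x := by
      rw [empiricalMean, meanCLM_apply, Finset.sum_add_distrib, smul_add, Finset.sum_const,
        Finset.card_univ, Fintype.card_fin, ← Nat.cast_smul_eq_nsmul ℝ, smul_smul,
        inv_mul_cancel₀ hN0.ne', one_smul, add_sub_cancel_left]
    simp only [Set.mem_preimage, Set.mem_ofPred_eq, this]
  have hRN : √(N : ℝ) * R =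
      √(∑ i, lam i) + √(2 * euclideanOpNorm V * Real.log (1 / δ)) := by
    have hs : √(N : ℝ) ≠ 0 := by positivity
    rw [hR, subgaussianRate, Real.sqrt_div' _ hN0.le, Real.sqrt_div' _ hN0.le, htr]
    field_simp
  have hset : f ⁻¹' (((√(N : ℝ))⁻¹ • ContinuousLinearMap.id ℝ (EuclideanSpace ℝ (Fin d))) ⁻¹' {w | ‖w‖ ≤ R}) =
      {x | (√(∑ i, lam i) + √(2 * euclideanOpNorm V * Real.log (1 / δ))) ^ 2 <
        ∑ i, lam i * x i ^ 2}ᶜ := by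
    ext x
    simp only [Set.mem_preimage, Set.mem_compl_iff, Set.mem_ofPred_eq, not_lt, _root_.smul_apply,
      ContinuousLinearMap.id_apply, norm_smul, norm_inv, Real.norm_eq_abs,
      abs_of_nonneg (Real.sqrt_nonneg _)]
    rw [← hnorm, sq_le_sq₀ (norm_nonneg _) (by positivity), ← hRN,
      inv_mul_le_iff₀ (by positivity)]
  have hmeas : MeasurableSet {x : Fin d → ℝ |
      (√(∑ i, lam i) + √(2 * euclideanOpNorm V * Real.log (1 / δ))) ^ 2 <
        ∑ i, lam i * x i ^ 2} := measurableSet_lt (by fun_prop) (by fun_prop)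
  rw [h1, ← hmap, map_measureReal_apply hf (hball.preimage (by fun_prop)), hset,
    probReal_compl_eq_one_sub hmeas]
  have h2 := measure_lt_sum_sq_le hlam0 hlam hℓ
  -- At `ℓ = log (1 / δ)` the failure probability `exp (-ℓ)` is exactly `δ`.
  rw [one_div, Real.log_inv, neg_neg, Real.exp_log hδ, ← Real.log_inv, ← one_div] at h2
  linarith

end Multivariate

/-- The numerical constant in the trace part of the lower bound is small. -/
lemma log_two_div_log_le : Real.log 2 / (2 * Real.log (5 / 4)) ≤ 5 / 2 := by
  have h1 : (1 / 5 : ℝ) ≤ Real.log (5 / 4) := by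
    have := Real.one_sub_inv_le_log_of_pos (show (0 : ℝ) < 5 / 4 by norm_num)
    norm_num at this ⊢
    linarith
  have h2 : Real.log 2 ≤ 1 := by linarith [Real.log_two_lt_d9]
  rw [div_le_iff₀ (by linarith)]
  linarith

theorem theorem4 :
    -- the lower bound, for every estimator
    (∀ (d N : ℕ), 0 < N → ∀ V : Matrix (Fin d) (Fin d) ℝ, V.PosSemidef →
      ∀ est : (Fin N → EuclideanSpace ℝ (Fin d)) → EuclideanSpace ℝ (Fin d), Measurable est →
      ∀ δ : ℝ, 0 < δ → δ ≤ 1 / 4 → ∀ r : ℝ, IsAccurate V est δ r →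
        max (1 / 24 * √(Real.log 2 / (2 * Real.log (5 / 4))) * √(V.trace / N))
          (1 / 12 * √(euclideanOpNorm V * Real.log (1 / δ) / N)) ≤ r) ∧
    -- the empirical mean attains the subgaussian rate
    (∀ (d N : ℕ), 0 < N → ∀ V : Matrix (Fin d) (Fin d) ℝ, V.PosSemidef →
      ∀ δ : ℝ, 0 < δ → δ < 1 →
        IsAccurate V (empiricalMean (N := N)) δ (subgaussianRate V N δ)) ∧
    -- hence, up to an absolute constant, no estimator improves on the empirical mean
    (∃ C : ℝ, 0 < C ∧ ∀ (d N : ℕ), 0 < N → ∀ V : Matrix (Fin d) (Fin d) ℝ, V.PosSemidef →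
      ∀ est : (Fin N → EuclideanSpace ℝ (Fin d)) → EuclideanSpace ℝ (Fin d), Measurable est →
      ∀ δ : ℝ, 0 < δ → δ ≤ 1 / 4 → ∀ r : ℝ, IsAccurate V est δ r →
        subgaussianRate V N δ ≤ C * r) := by
  -- `24 = 7 + 17`, where `√40 ≤ 7` serves the trace term and `√(2 * 144) ≤ 17` the operator norm
  -- term.
  refine ⟨?_, fun d N hN V hV δ hδ hδ1 => isAccurate_empiricalMean hN hV hδ hδ1, 24, by norm_num, ?_⟩
  · intro d N hN V hV est hest δ hδ hδ4 r h
    obtain ⟨hr, hT, hop⟩ := h.bounds hN hV hest hδ hδ4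
    refine max_le ?_ ?_
    · have h1 : √(Real.log 2 / (2 * Real.log (5 / 4))) ≤ 2 :=
        Real.sqrt_le_iff.2 ⟨by norm_num, log_two_div_log_le.trans (by norm_num)⟩
      have h2 : √(V.trace / N) ≤ 7 * r :=
        Real.sqrt_le_iff.2 ⟨by positivity, by nlinarith [sq_nonneg r]⟩
      have := mul_le_mul h1 h2 (Real.sqrt_nonneg _) zero_le_two
      linarith
    · have : √(euclideanOpNorm V * Real.log (1 / δ) / N) ≤ 12 * r :=
        Real.sqrt_le_iff.2 ⟨by positivity, by nlinarith [sq_nonneg r]⟩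
      linarith
  · intro d N hN V hV est hest δ hδ hδ4 r h
    obtain ⟨hr, hT, hop⟩ := h.bounds hN hV hest hδ hδ4
    have h1 : √(V.trace / N) ≤ 7 * r :=
      Real.sqrt_le_iff.2 ⟨by positivity, by nlinarith [sq_nonneg r]⟩
    have h2 : √(2 * euclideanOpNorm V * Real.log (1 / δ) / N) ≤ 17 * r := by
      refine Real.sqrt_le_iff.2 ⟨by positivity, ?_⟩
      rw [mul_assoc, mul_div_assoc]
      nlinarith [sq_nonneg r]
    rw [subgaussianRate]
    linarith
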